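/- Let $n\ge 1$, let $\langle x,y\rangle=x^1y^1+\dots+x^{2n}y^{2n}-x^{2n+1}y^{2n+1}$ be the Minkowski product on $\mathbb R^{2n+1}$, extended complex-bilinearly to $\mathbb C^{2n+1}$, write $\|v\|^2=\langle v,\bar v\rangle\in\mathbb R$ for $v\in\mathbb C^{2n+1}$, and let $S^{2n}_1=\{x\in\mathbb R^{2n+1}:\langle x,x\rangle=1\}$ be de Sitter space. A map $f:\mathbb C\to S^{2n}_1$ is called superconformal if it is smooth, harmonic (its tension field, i.e. the component $\Delta f-\langle\Delta f,f\rangle f$ of the Laplacian tangent to $S^{2n}_1$, vanishes), and has isotropy order $n-1$, that is, $\langle\partial_z^a f,\partial_z^b f\rangle\equiv 0$ for all integers $a,b\ge 0$ with $1\le a+b\le 2n-1$, while $\langle\partial_z^n f,\partial_z^n f\rangle\not\equiv 0$. The harmonic sequence $f_0,f_1,f_2,\dots$ of $f$ is defined inductively by $f_0=f$ and $$f_{j+1}=\partial_z f_j-\frac{\langle\partial_z f_j,\overline{f_j}\rangle}{\|f_j\|^2}\,f_j\quad\text{wherever } \|f_j\|^2\ne 0,$$ extended by continuity, where possible, to the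 points where $f_j=0$; at all other points (in particular where $f_j\neq 0$ but $\|f_j\|^2=0$) $f_{j+1}$ is undefined. Let $f:\mathbb C\to S^{2n}_1$ be superconformal and doubly periodic (it has two periods that are linearly independent over $\mathbb R$), and suppose that the elements $f_1,\dots,f_n$ of its harmonic sequence are defined on all of $\mathbb C$. Then $\langle\partial_z^n f,\partial_z^n f\rangle$ is a nonzero constant function on $\mathbb C$. Moreover $f_1,\dots,f_{n-1}$ are spacelike everywhere: $\|f_j(z)\|^2>0$ for all $z\in\mathbb C$ and $1\le j\le n-1$. -/

import Mathlib

open Set Filter Topology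
open scoped ContDiff

namespace DeSitter

/-- The Minkowski product `x¹y¹ + ⋯ + x²ⁿy²ⁿ - x²ⁿ⁺¹y²ⁿ⁺¹` on `R²ⁿ⁺¹`: for `R = ℝ` the inner
product of `ℝ^{2n,1}`, for `R = ℂ` its complex bilinear extension. -/
def minkowski {R : Type*} [CommRing R] {n : ℕ} (x y : Fin (2 * n + 1) → R) : R :=
  (∑ i : Fin (2 * n), x i.castSucc * y i.castSucc) - x (Fin.last (2 * n)) * y (Fin.last (2 * n))

/-- De Sitter space `S^{2n}_1`, the unit sphere of `ℝ^{2n,1}`. -/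
def deSitter (n : ℕ) : Set (Fin (2 * n + 1) → ℝ) := {x | minkowski x x = 1}

/-- `‖v‖² = ⟨v, v̄⟩` (possibly zero or negative). -/
noncomputable def hermSq {n : ℕ} (v : Fin (2 * n + 1) → ℂ) : ℂ :=
  minkowski v (star v)

theorem hermSq_im {n : ℕ} (v : Fin (2 * n + 1) → ℂ) : (hermSq v).im = 0 := by
  simp [hermSq, minkowski, Complex.mul_conj]

/-- `‖v‖² > 0`; the number `‖v‖²` is real by `hermSq_im`. -/
def IsSpacelike {n : ℕ} (v : Fin (2 * n + 1) → ℂ) : Prop := 0 < (hermSq v).re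

/-- A real map, regarded as a map into the complexification. -/
def complexify {n : ℕ} (f : ℂ → Fin (2 * n + 1) → ℝ) : ℂ → Fin (2 * n + 1) → ℂ :=
  fun z i => (f z i : ℂ)

/-- The operator `∂_z = ½ (∂_x - i ∂_y)`. -/
noncomputable def dz {n : ℕ} (g : ℂ → Fin (2 * n + 1) → ℂ) : ℂ → Fin (2 * n + 1) → ℂ :=
  fun z => (1 / 2 : ℂ) • (fderiv ℝ g z 1 - Complex.I • fderiv ℝ g z Complex.I)

/-- The iterated derivative `∂_z^a f` of a real map `f`. -/
noncomputable def dzIter {n : ℕ} (a : ℕ) (f : ℂ → Fin (2 * n + 1) → ℝ) :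
    ℂ → Fin (2 * n + 1) → ℂ :=
  dz^[a] (complexify f)

/-- The tension field of a map `f` into `S^{2n}_1`. The Levi-Civita connection of `S^{2n}_1` is
the tangential part of the flat one, and `T_p S^{2n}_1 = p^⊥` with `⟨p, p⟩ = 1`, so the tension
field is the component of the Laplacian of `f` orthogonal to `f`. -/
noncomputable def tension {n : ℕ} (f : ℂ → Fin (2 * n + 1) → ℝ) : ℂ → Fin (2 * n + 1) → ℝ :=
  fun z => Laplacian.laplacian f z - minkowski (Laplacian.laplacian f z) (f z) • f z

/-- Harmonic maps `ℂ → S^{2n}_1`: smooth maps with vanishing tension field. -/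
structure IsHarmonicMap {n : ℕ} (f : ℂ → Fin (2 * n + 1) → ℝ) : Prop where
  mem_deSitter : ∀ z, f z ∈ deSitter n
  smooth : ContDiff ℝ ∞ f
  tension_eq_zero : ∀ z, tension f z = 0

/-- `f` has isotropy order `r`. -/
structure HasIsotropyOrder {n : ℕ} (f : ℂ → Fin (2 * n + 1) → ℝ) (r : ℕ) : Prop where
  isotropic : ∀ a b : ℕ, 1 ≤ a + b → a + b ≤ 2 * r + 1 →
    ∀ z, minkowski (dzIter a f z) (dzIter b f z) = 0
  maximal : ∃ z, minkowski (dzIter (r + 1) f z) (dzIter (r + 1) f z) ≠ 0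

/-- Superconformal maps `ℂ → S^{2n}_1` (`n ≥ 1`): harmonic maps of isotropy order `n - 1`. -/
structure IsSuperconformal {n : ℕ} (f : ℂ → Fin (2 * n + 1) → ℝ) : Prop where
  harmonic : IsHarmonicMap f
  order : HasIsotropyOrder f (n - 1)

/-- `f` has two periods that are linearly independent over `ℝ`. -/
def IsDoublyPeriodic {n : ℕ} (f : ℂ → Fin (2 * n + 1) → ℝ) : Prop :=
  ∃ ω₁ ω₂ : ℂ, LinearIndependent ℝ ![ω₁, ω₂] ∧ Function.Periodic f ω₁ ∧ Function.Periodic f ω₂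

/-- A partially defined map on `ℂ`: a domain, and a total function whose values off the domain
are irrelevant. -/
structure PartialMap (n : ℕ) where
  domain : Set ℂ
  toFun : ℂ → Fin (2 * n + 1) → ℂ

namespace PartialMap

/-- `∂_z g - (⟨∂_z g, ḡ⟩ / ‖g‖²) g`, meaningful at the points of `g.regularSet`. -/
noncomputable def gramSchmidt {n : ℕ} (g : PartialMap n) : ℂ → Fin (2 * n + 1) → ℂ :=
  fun z => dz g.toFun z -
    (minkowski (dz g.toFun z) (star (g.toFun z)) / hermSq (g.toFun z)) • g.toFun z

/-- The points near which `g` is defined and at which `‖g‖² ≠ 0`. -/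
def regularSet {n : ℕ} (g : PartialMap n) : Set ℂ :=
  {z | g.domain ∈ 𝓝 z ∧ hermSq (g.toFun z) ≠ 0}

/-- The zeros of `g` to which the Gram-Schmidt expression extends by continuity. -/
def extensionSet {n : ℕ} (g : PartialMap n) : Set ℂ :=
  {z | z ∈ g.domain ∧ g.toFun z = 0 ∧ z ∈ closure g.regularSet ∧
    ∃ l, Tendsto g.gramSchmidt (𝓝[g.regularSet] z) (𝓝 l)}

open Classical in
/-- The next element of the harmonic sequence: the Gram-Schmidt expression wherever `‖g‖² ≠ 0`,
extended by continuity to the zeros of `g`, and undefined elsewhere. -/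
noncomputable def next {n : ℕ} (g : PartialMap n) : PartialMap n where
  domain := g.regularSet ∪ g.extensionSet
  toFun := fun z =>
    if z ∈ g.regularSet then g.gramSchmidt z else extendFrom g.regularSet g.gramSchmidt z

end PartialMap

/-- The harmonic sequence `f₀ = f, f₁, f₂, …` of `f`. -/
noncomputable def harmonicSequence {n : ℕ} (f : ℂ → Fin (2 * n + 1) → ℝ) : ℕ → PartialMap n
  | 0 => ⟨univ, complexify f⟩
  | j + 1 => (harmonicSequence f j).next

end DeSitter

/-! Harmonicity reads `∂_{z̄} ∂_z f = λ f`, so `∂_{z̄} ∂_z^n f` is a combination of derivatives of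
order below `n` (`IsHarmonicMap.wirtinger_dzIter`). Isotropy makes these orthogonal to `∂_z^n f`, so
`⟨∂_z^n f, ∂_z^n f⟩` is entire; being doubly periodic it is a constant `c` by Liouville, and `c ≠ 0`
by maximality of the isotropy order.

Moving derivatives across the product gives `⟨∂_z^j f, ∂_z^{2n-j} f⟩ = ±c` for `j ≤ n`. Since `f_j`
is `∂_z^j f` plus derivatives of orders `1, …, j-1`, its product with `∂_z^{2n-j} f` is also `±c`,
so `f_j` has no zeros. For `j < n`, as `f_{j+1}` is defined everywhere, `‖f_j‖²` never vanishes.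
Moreover `f_j` is then isotropic, and isotropic vectors in Lorentzian signature have `‖v‖² ≥ 0`;
hence `‖f_j‖² > 0`. -/

namespace DeSitter

/-! ### Algebra of the Minkowski product. -/

section Minkowski

variable {R : Type*} [CommRing R] {n : ℕ}

theorem minkowski_comm (x y : Fin (2 * n + 1) → R) : minkowski x y = minkowski y x := by
  simp [minkowski, mul_comm]

theorem minkowski_add_left (x x' y : Fin (2 * n + 1) → R) :
    minkowski (x + x') y = minkowski x y + minkowski x' y := by
  simp only [minkowski, Pi.add_apply, add_mul, Finset.sum_add_distrib]
  ring

theorem minkowski_add_right (x y y' : Fin (2 * n + 1) → R) :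
    minkowski x (y + y') = minkowski x y + minkowski x y' := by
  rw [minkowski_comm, minkowski_add_left, minkowski_comm y, minkowski_comm y']

theorem minkowski_smul_left (a : R) (x y : Fin (2 * n + 1) → R) :
    minkowski (a • x) y = a * minkowski x y := by
  simp only [minkowski, Pi.smul_apply, smul_eq_mul, mul_assoc, ← Finset.mul_sum]
  ring

theorem minkowski_smul_right (a : R) (x y : Fin (2 * n + 1) → R) :
    minkowski x (a • y) = a * minkowski x y := by
  rw [minkowski_comm, minkowski_smul_left, minkowski_comm]

theorem minkowski_zero_left (y : Fin (2 * n + 1) → R) : minkowski 0 y = 0 := by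
  simp [minkowski]

end Minkowski

variable {n : ℕ}

/-- Isotropy says that the square of the timelike coordinate is the sum of the squares of the
others; the triangle inequality compares the moduli. -/
theorem hermSq_re_nonneg_of_isotropic {v : Fin (2 * n + 1) → ℂ} (hv : minkowski v v = 0) :
    0 ≤ (hermSq v).re := by
  set t := v (Fin.last (2 * n)) with ht
  have hsum : ∑ i : Fin (2 * n), v i.castSucc * v i.castSucc = t * t := by
    simpa [minkowski, sub_eq_zero] using hv
  have hle : ‖t‖ ^ 2 ≤ ∑ i : Fin (2 * n), ‖v i.castSucc‖ ^ 2 := by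
    calc ‖t‖ ^ 2 = ‖∑ i : Fin (2 * n), v i.castSucc * v i.castSucc‖ := by
          rw [hsum, norm_mul, sq]
      _ ≤ ∑ i : Fin (2 * n), ‖v i.castSucc * v i.castSucc‖ := norm_sum_le _ _
      _ = _ := by simp [sq]
  have hre : (hermSq v).re = ∑ i : Fin (2 * n), ‖v i.castSucc‖ ^ 2 - ‖t‖ ^ 2 := by
    simp only [hermSq, minkowski, Pi.star_apply, Complex.star_def, Complex.mul_conj',
      ← Complex.ofReal_pow, Complex.sub_re, Complex.re_sum, Complex.ofReal_re, ht]
  rw [hre]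
  exact sub_nonneg.2 hle

/-! ### Calculus of `∂_z` and `∂_{z̄}`, and Liouville's theorem for doubly periodic functions. -/

section Wirtinger

variable {E : Type*} [NormedAddCommGroup E] [NormedSpace ℝ E] [NormedSpace ℂ E]

/-- The first-order operator `½ (∂_x + s ∂_y)`: it is `∂_z` for `s = -i` and `∂_{z̄}` for `s = i`. -/
noncomputable def wirtinger (s : ℂ) (g : ℂ → E) : ℂ → E :=
  fun z => (1 / 2 : ℂ) • (fderiv ℝ g z 1 + s • fderiv ℝ g z Complex.I)

theorem dz_eq_wirtinger (g : ℂ → Fin (2 * n + 1) → ℂ) : dz g = wirtinger (-Complex.I) g := by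
  funext z
  simp [dz, wirtinger, sub_eq_add_neg]

theorem contDiff_fderiv_apply {E : Type*} [NormedAddCommGroup E] [NormedSpace ℝ E] {g : ℂ → E}
    (hg : ContDiff ℝ ∞ g) (v : ℂ) : ContDiff ℝ ∞ (fun z => fderiv ℝ g z v) :=
  (hg.fderiv_right (m := ∞) (by simp)).clm_apply contDiff_const

theorem contDiff_wirtinger [IsScalarTower ℝ ℂ E] {g : ℂ → E} (hg : ContDiff ℝ ∞ g) (s : ℂ) :
    ContDiff ℝ ∞ (wirtinger s g) :=
  contDiff_const.smul ((contDiff_fderiv_apply hg 1).add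
    (contDiff_const.smul (contDiff_fderiv_apply hg Complex.I)))

theorem fderiv_wirtinger [IsScalarTower ℝ ℂ E] {g : ℂ → E} (hg : ContDiff ℝ ∞ g) (s z v : ℂ) :
    fderiv ℝ (wirtinger s g) z v = (1 / 2 : ℂ) •
      (fderiv ℝ (fderiv ℝ g) z v 1 + s • fderiv ℝ (fderiv ℝ g) z v Complex.I) := by
  have hd : HasFDerivAt (fderiv ℝ g) (fderiv ℝ (fderiv ℝ g) z) z :=
    ((hg.fderiv_right (m := ∞) (by simp)).differentiable (by simp) z).hasFDerivAt
  have h1 := hd.clm_apply (hasFDerivAt_const (1 : ℂ) z)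
  have hI := hd.clm_apply (hasFDerivAt_const Complex.I z)
  have h := ((h1.add (hI.const_smul s)).const_smul (1 / 2 : ℂ)).fderiv
  have h' : fderiv ℝ (wirtinger s g) z = _ := h
  rw [h']
  simp

theorem fderiv_fderiv_symm {E : Type*} [NormedAddCommGroup E] [NormedSpace ℝ E] {g : ℂ → E}
    (hg : ContDiff ℝ ∞ g) (z v w : ℂ) :
    fderiv ℝ (fderiv ℝ g) z v w = fderiv ℝ (fderiv ℝ g) z w v :=
  hg.contDiffAt.isSymmSndFDerivAt (by
    rw [minSmoothness_of_isRCLikeNormedField]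
    exact WithTop.coe_le_coe.2 (le_top (a := (2 : ℕ∞)))) v w

theorem wirtinger_comm [IsScalarTower ℝ ℂ E] {g : ℂ → E} (hg : ContDiff ℝ ∞ g) (s t : ℂ) :
    wirtinger s (wirtinger t g) = wirtinger t (wirtinger s g) := by
  funext z
  have hsymm : fderiv ℝ (fderiv ℝ g) z Complex.I 1 = fderiv ℝ (fderiv ℝ g) z 1 Complex.I :=
    fderiv_fderiv_symm hg z _ _
  rw [wirtinger, wirtinger]
  simp only [fderiv_wirtinger hg, hsymm]
  module

theorem wirtinger_add {g h : ℂ → E} (hg : ContDiff ℝ ∞ g) (hh : ContDiff ℝ ∞ h) (s : ℂ) :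
    wirtinger s (fun z => g z + h z) = fun z => wirtinger s g z + wirtinger s h z := by
  funext z
  rw [wirtinger, fderiv_fun_add (hg.differentiable (by simp) z) (hh.differentiable (by simp) z)]
  simp only [wirtinger, _root_.add_apply]
  module

theorem wirtinger_smul [IsScalarTower ℝ ℂ E] {a : ℂ → ℂ} {g : ℂ → E} (ha : ContDiff ℝ ∞ a)
    (hg : ContDiff ℝ ∞ g) (s : ℂ) :
    wirtinger s (fun z => a z • g z) =
      fun z => wirtinger s a z • g z + a z • wirtinger s g z := by
  funext z
  rw [wirtinger, fderiv_fun_smul (ha.differentiable (by simp) z) (hg.differentiable (by simp) z)]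
  simp only [wirtinger, _root_.add_apply, _root_.smul_apply,
    ContinuousLinearMap.smulRight_apply, smul_eq_mul]
  module

theorem wirtinger_periodic {g : ℂ → E} {τ : ℂ} (hg : Function.Periodic g τ) (s : ℂ) :
    Function.Periodic (wirtinger s g) τ := by
  intro z
  have h : fderiv ℝ g (z + τ) = fderiv ℝ g z := by
    rw [← fderiv_comp_add_right, hg.funext]
  simp only [wirtinger, h]

theorem wirtinger_zero (s : ℂ) : wirtinger s (fun _ => (0 : E)) = fun _ => 0 := by
  funext z
  simp [wirtinger]

end Wirtinger

theorem contDiff_dz {g : ℂ → Fin (2 * n + 1) → ℂ} (hg : ContDiff ℝ ∞ g) :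
    ContDiff ℝ ∞ (dz g) := by
  rw [dz_eq_wirtinger]
  exact contDiff_wirtinger hg _

theorem contDiff_minkowski {g h : ℂ → Fin (2 * n + 1) → ℂ} (hg : ContDiff ℝ ∞ g)
    (hh : ContDiff ℝ ∞ h) : ContDiff ℝ ∞ (fun z => minkowski (g z) (h z)) := by
  unfold minkowski
  rw [contDiff_pi] at hg hh
  exact (ContDiff.sum fun i _ => (hg _).mul (hh _)).sub ((hg _).mul (hh _))

theorem fderiv_minkowski {g h : ℂ → Fin (2 * n + 1) → ℂ} (hg : ContDiff ℝ ∞ g)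
    (hh : ContDiff ℝ ∞ h) (z v : ℂ) :
    fderiv ℝ (fun z => minkowski (g z) (h z)) z v =
      minkowski (fderiv ℝ g z v) (h z) + minkowski (g z) (fderiv ℝ h z v) := by
  have hg' := hasFDerivAt_pi'.1 (hg.differentiable (by simp) z).hasFDerivAt
  have hh' := hasFDerivAt_pi'.1 (hh.differentiable (by simp) z).hasFDerivAt
  have key := (HasFDerivAt.fun_sum (u := Finset.univ) fun (i : Fin (2 * n)) _ =>
    (hg' i.castSucc).mul (hh' i.castSucc)).sub
      ((hg' (Fin.last (2 * n))).mul (hh' (Fin.last (2 * n))))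
  have key' : fderiv ℝ (fun z => minkowski (g z) (h z)) z = _ := key.fderiv
  rw [key']
  simp only [minkowski, _root_.sub_apply, _root_.sum_apply,
    _root_.add_apply, _root_.smul_apply, ContinuousLinearMap.comp_apply,
    ContinuousLinearMap.proj_apply, smul_eq_mul, Finset.sum_add_distrib]
  simp only [mul_comm (h z _)]
  ring

theorem wirtinger_minkowski {g h : ℂ → Fin (2 * n + 1) → ℂ} (hg : ContDiff ℝ ∞ g)
    (hh : ContDiff ℝ ∞ h) (s z : ℂ) :
    wirtinger s (fun z => minkowski (g z) (h z)) z =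
      minkowski (wirtinger s g z) (h z) + minkowski (g z) (wirtinger s h z) := by
  simp only [wirtinger, fderiv_minkowski hg hh, minkowski_smul_left, minkowski_smul_right,
    minkowski_add_left, minkowski_add_right, smul_eq_mul]
  ring

/-- A doubly periodic entire function is constant. -/
theorem apply_eq_of_doublyPeriodic {h : ℂ → ℂ} (hh : Differentiable ℂ h) {ω₁ ω₂ : ℂ}
    (hω : LinearIndependent ℝ ![ω₁, ω₂]) (h₁ : Function.Periodic h ω₁)
    (h₂ : Function.Periodic h ω₂) (z w : ℂ) : h z = h w := by
  let b := basisOfLinearIndependentOfCardEqFinrank hω (by simp)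
  have hb : ⇑b = ![ω₁, ω₂] := coe_basisOfLinearIndependentOfCardEqFinrank hω _
  -- Reduction to the fundamental parallelogram subtracts integer multiples of the periods.
  have hfract (z : ℂ) : h (ZSpan.fract b z) = h z := by
    rw [ZSpan.fract_apply, ZSpan.floor]
    simp only [Fin.sum_univ_two, Submodule.coe_add, Submodule.coe_smul,
      Module.Basis.restrictScalars_apply, hb, Matrix.cons_val_zero, Matrix.cons_val_one, ← sub_sub]
    rw [h₂.sub_zsmul_eq, h₁.sub_zsmul_eq]
  refine hh.apply_eq_apply_of_bounded ?_ z w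
  have hcomp : IsCompact (closure (ZSpan.fundamentalDomain b)) :=
    (ZSpan.fundamentalDomain_isBounded b).isCompact_closure
  refine (hcomp.image hh.continuous).isBounded.subset ?_
  rintro _ ⟨z, rfl⟩
  exact ⟨_, subset_closure (ZSpan.fract_mem_fundamentalDomain b z), hfract z⟩

/-! ### Iterated derivatives of `f` and their combinations. -/

section Derivatives

variable {f : ℂ → Fin (2 * n + 1) → ℝ}

theorem contDiff_complexify (hf : ContDiff ℝ ∞ f) : ContDiff ℝ ∞ (complexify f) := by
  rw [contDiff_pi] at hf ⊢
  exact fun i => Complex.ofRealCLM.contDiff.comp (hf i)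

theorem dzIter_succ (k : ℕ) (f : ℂ → Fin (2 * n + 1) → ℝ) :
    dzIter (k + 1) f = dz (dzIter k f) :=
  Function.iterate_succ_apply' _ _ _

theorem contDiff_dzIter (hf : ContDiff ℝ ∞ f) (k : ℕ) : ContDiff ℝ ∞ (dzIter k f) := by
  induction k with
  | zero => exact contDiff_complexify hf
  | succ k ih =>
    rw [dzIter_succ]
    exact contDiff_dz ih

theorem dzIter_periodic {τ : ℂ} (hf : Function.Periodic f τ) (k : ℕ) :
    Function.Periodic (dzIter k f) τ := by
  induction k with
  | zero =>
    intro z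
    funext i
    simp [dzIter, complexify, hf z]
  | succ k ih =>
    rw [dzIter_succ, dz_eq_wirtinger]
    exact wirtinger_periodic ih _

/-- Linear combinations of the derivatives `∂_z^k f`, `lo ≤ k < hi`, with smooth coefficients. -/
inductive IsDerivComb (f : ℂ → Fin (2 * n + 1) → ℝ) (lo hi : ℕ) :
    (ℂ → Fin (2 * n + 1) → ℂ) → Prop
  | zero : IsDerivComb f lo hi (fun _ => 0)
  | add_smul {g : ℂ → Fin (2 * n + 1) → ℂ} {a : ℂ → ℂ} {k : ℕ} (hg : IsDerivComb f lo hi g)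
      (ha : ContDiff ℝ ∞ a) (hlo : lo ≤ k) (hhi : k < hi) :
      IsDerivComb f lo hi (fun z => g z + a z • dzIter k f z)

namespace IsDerivComb

variable {lo hi : ℕ} {g h : ℂ → Fin (2 * n + 1) → ℂ}

theorem mono {hi' : ℕ} (hg : IsDerivComb f lo hi g) (hle : hi ≤ hi') :
    IsDerivComb f lo hi' g := by
  induction hg with
  | zero => exact zero
  | add_smul _ ha hlo hhi ih => exact ih.add_smul ha hlo (hhi.trans_le hle)

theorem add (hg : IsDerivComb f lo hi g) (hh : IsDerivComb f lo hi h) :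
    IsDerivComb f lo hi (fun z => g z + h z) := by
  induction hh with
  | zero => simpa using hg
  | add_smul _ ha hlo hhi ih =>
    simp only [← add_assoc]
    exact ih.add_smul ha hlo hhi

theorem smul {b : ℂ → ℂ} (hb : ContDiff ℝ ∞ b) (hg : IsDerivComb f lo hi g) :
    IsDerivComb f lo hi (fun z => b z • g z) := by
  induction hg with
  | zero => simpa using zero
  | add_smul _ ha hlo hhi ih =>
    simp only [smul_add, smul_smul]
    exact ih.add_smul (hb.mul ha) hlo hhi

theorem contDiff (hf : ContDiff ℝ ∞ f) (hg : IsDerivComb f lo hi g) : ContDiff ℝ ∞ g := by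
  induction hg with
  | zero => exact contDiff_const
  | add_smul _ ha _ _ ih => exact ih.add (ha.smul (contDiff_dzIter hf _))

theorem dz (hf : ContDiff ℝ ∞ f) (hg : IsDerivComb f lo hi g) :
    IsDerivComb f lo (hi + 1) (dz g) := by
  rw [dz_eq_wirtinger]
  induction hg with
  | zero =>
    rw [wirtinger_zero]
    exact zero
  | @add_smul g a k hg ha hlo hhi ih =>
    have hk := contDiff_dzIter hf k
    rw [wirtinger_add (hg.contDiff hf) (h := fun z => a z • dzIter k f z) (ha.smul hk),
      wirtinger_smul ha hk, ← dz_eq_wirtinger,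
      ← dz_eq_wirtinger (dzIter k f), ← dzIter_succ]
    simp only [← add_assoc]
    rw [dz_eq_wirtinger]
    exact (ih.add_smul (contDiff_wirtinger ha _) hlo (by omega)).add_smul ha (by omega) (by omega)

/-- This transfers the isotropy relations from the derivatives themselves to their combinations. -/
theorem minkowski_eq_zero (hg : IsDerivComb f lo hi g) {z : ℂ} {v : Fin (2 * n + 1) → ℂ}
    (hv : ∀ k, lo ≤ k → k < hi → minkowski (dzIter k f z) v = 0) : minkowski (g z) v = 0 := by
  induction hg with
  | zero => exact minkowski_zero_left _
  | add_smul _ _ hlo hhi ih =>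
    rw [minkowski_add_left, minkowski_smul_left, ih, hv _ hlo hhi, mul_zero, add_zero]

end IsDerivComb

theorem fderiv_fderiv_complexify (hf : ContDiff ℝ ∞ f) (z v w : ℂ) :
    fderiv ℝ (fderiv ℝ (complexify f)) z v w =
      fun i => ((fderiv ℝ (fderiv ℝ f) z v w i : ℝ) : ℂ) := by
  let L : (Fin (2 * n + 1) → ℝ) →L[ℝ] (Fin (2 * n + 1) → ℂ) :=
    ContinuousLinearMap.pi fun i => Complex.ofRealCLM.comp (ContinuousLinearMap.proj i)
  have h1 : fderiv ℝ (complexify f) = fun z => L.comp (fderiv ℝ f z) := by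
    funext z
    exact (L.hasFDerivAt.comp z (hf.differentiable (by simp) z).hasFDerivAt).fderiv
  have hd : DifferentiableAt ℝ (fderiv ℝ f) z :=
    (hf.fderiv_right (m := ∞) (by simp)).differentiable (by simp) z
  rw [h1, ((hasFDerivAt_const L z).clm_comp hd.hasFDerivAt).fderiv]
  funext i
  simp [L]

/-- The mixed second derivatives cancel by symmetry, leaving a quarter of the Laplacian. -/
theorem wirtinger_dz_complexify (hf : ContDiff ℝ ∞ f) (z : ℂ) :
    wirtinger Complex.I (dz (complexify f)) z =
      fun i => (1 / 4 : ℂ) * ((Laplacian.laplacian f z i : ℝ) : ℂ) := by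
  have hc := contDiff_complexify hf
  have hsymm : fderiv ℝ (fderiv ℝ (complexify f)) z Complex.I 1 =
      fderiv ℝ (fderiv ℝ (complexify f)) z 1 Complex.I :=
    fderiv_fderiv_symm hc z _ _
  have hlap : Laplacian.laplacian f z =
      fderiv ℝ (fderiv ℝ f) z 1 1 + fderiv ℝ (fderiv ℝ f) z Complex.I Complex.I := by
    simp [InnerProductSpace.laplacian_eq_iteratedFDeriv_complexPlane, iteratedFDeriv_two_apply]
  rw [dz_eq_wirtinger, wirtinger]
  simp only [fderiv_wirtinger hc, hsymm]
  simp only [fderiv_fderiv_complexify hf, hlap]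
  funext i
  simp only [Pi.add_apply, Pi.smul_apply, smul_eq_mul, Complex.ofReal_add]
  linear_combination (-1 / 4 * ((fderiv ℝ (fderiv ℝ f) z Complex.I Complex.I i : ℝ) : ℂ)) *
    Complex.I_sq

end Derivatives

/-! ### Consequences of the harmonic map equation. -/

section Harmonic

variable {f : ℂ → Fin (2 * n + 1) → ℝ}

theorem IsHarmonicMap.minkowski_complexify (hf : IsHarmonicMap f) (z : ℂ) :
    minkowski (complexify f z) (complexify f z) = 1 := by
  have h : minkowski (f z) (f z) = 1 := hf.mem_deSitter z
  have h' := congrArg (fun x : ℝ => (x : ℂ)) h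
  simpa [minkowski, complexify] using h'

/-- The harmonic map equation `∂_{z̄} ∂_z f = λ f`. -/
theorem IsHarmonicMap.wirtinger_dz (hf : IsHarmonicMap f) :
    IsDerivComb f 0 1 (wirtinger Complex.I (dz (complexify f))) := by
  have hc := contDiff_complexify hf.smooth
  have hs := contDiff_wirtinger (contDiff_dz hc) Complex.I
  -- Vanishing tension gives only a pointwise multiplier; pairing with `f`, where `⟨f, f⟩ = 1`,
  -- recovers it as a visibly smooth function.
  have heq : wirtinger Complex.I (dz (complexify f)) = fun z => 0 +
      minkowski (wirtinger Complex.I (dz (complexify f)) z) (complexify f z) • dzIter 0 f z := by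
    funext z
    obtain ⟨μ, hμ⟩ : ∃ μ : ℂ,
        wirtinger Complex.I (dz (complexify f)) z = μ • complexify f z := by
      refine ⟨(1 / 4 : ℂ) * ((minkowski (Laplacian.laplacian f z) (f z) : ℝ) : ℂ), ?_⟩
      rw [wirtinger_dz_complexify hf.smooth]
      funext i
      have ht := congrFun (sub_eq_zero.1 (hf.tension_eq_zero z)) i
      rw [Pi.smul_apply, smul_eq_mul] at ht
      rw [Pi.smul_apply, smul_eq_mul, complexify, mul_assoc, ← Complex.ofReal_mul, ← ht]
    have hz : dzIter 0 f z = complexify f z := rfl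
    rw [hμ, minkowski_smul_left, hf.minkowski_complexify, mul_one, zero_add, hz]
  rw [heq]
  exact IsDerivComb.zero.add_smul (contDiff_minkowski hs hc) le_rfl one_pos

/-- `∂_{z̄}` commutes with `∂_z`, and each further `∂_z` raises the top order by one. -/
theorem IsHarmonicMap.wirtinger_dzIter (hf : IsHarmonicMap f) (k : ℕ) :
    IsDerivComb f 0 (k + 1) (wirtinger Complex.I (dzIter (k + 1) f)) := by
  induction k with
  | zero => exact hf.wirtinger_dz
  | succ k ih =>
    rw [dzIter_succ, dz_eq_wirtinger, wirtinger_comm (contDiff_dzIter hf.smooth _),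
      ← dz_eq_wirtinger]
    exact ih.dz hf.smooth

end Harmonic

/-! ### Products of derivatives of a superconformal map. -/

section Superconformal

variable {f : ℂ → Fin (2 * n + 1) → ℝ}

theorem IsSuperconformal.minkowski_dzIter_eq_zero (hn : 1 ≤ n) (hf : IsSuperconformal f)
    {a b : ℕ} (h₁ : 1 ≤ a + b) (h₂ : a + b < 2 * n) (z : ℂ) :
    minkowski (dzIter a f z) (dzIter b f z) = 0 :=
  hf.order.isotropic a b h₁ (by omega) z

theorem IsSuperconformal.minkowski_dzIter_const (hn : 1 ≤ n) (hf : IsSuperconformal f)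
    (hper : IsDoublyPeriodic f) :
    ∃ c : ℂ, c ≠ 0 ∧ ∀ z, minkowski (dzIter n f z) (dzIter n f z) = c := by
  have hs := hf.harmonic.smooth
  have hsn := contDiff_dzIter hs n
  have hdb (z : ℂ) :
      wirtinger Complex.I (fun z => minkowski (dzIter n f z) (dzIter n f z)) z = 0 := by
    have hzero : minkowski (wirtinger Complex.I (dzIter n f) z) (dzIter n f z) = 0 := by
      -- The orders that occur are at most `n - 1`, so total orders lie between `n ≥ 1` and `2n -
      -- 1`, the range of isotropy.
      obtain ⟨m, rfl⟩ : ∃ m, n = m + 1 := ⟨n - 1, by omega⟩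
      exact (hf.harmonic.wirtinger_dzIter m).minkowski_eq_zero fun k _ hk =>
        hf.minkowski_dzIter_eq_zero hn (by omega) (by omega) z
    rw [wirtinger_minkowski hsn hsn, minkowski_comm (dzIter n f z), hzero, add_zero]
  have hdiff : Differentiable ℂ (fun z => minkowski (dzIter n f z) (dzIter n f z)) := by
    intro z
    refine differentiableAt_complex_iff_differentiableAt_real.2
      ⟨(contDiff_minkowski hsn hsn).differentiable (by simp) z, ?_⟩
    -- Vanishing of `∂_{z̄}` is the Cauchy–Riemann equation.
    have h := hdb z
    simp only [wirtinger, smul_eq_mul] at h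
    rw [smul_eq_mul]
    linear_combination (-2 * Complex.I) * h +
      fderiv ℝ (fun z => minkowski (dzIter n f z) (dzIter n f z)) z Complex.I * Complex.I_sq
  obtain ⟨ω₁, ω₂, hω, h₁, h₂⟩ := hper
  obtain ⟨z₀, hz₀⟩ := hf.order.maximal
  rw [Nat.sub_add_cancel hn] at hz₀
  have hp {τ : ℂ} (h : Function.Periodic f τ) :
      Function.Periodic (fun z => minkowski (dzIter n f z) (dzIter n f z)) τ := fun z => by
    simp only [dzIter_periodic h n z]
  exact ⟨_, hz₀, fun z => apply_eq_of_doublyPeriodic hdiff hω (hp h₁) (hp h₂) z z₀⟩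

/-- Differentiating a product of total order `2n - 1`, which vanishes by isotropy, moves one
derivative across at the cost of a sign. -/
theorem IsSuperconformal.minkowski_dzIter_add_sub (hn : 1 ≤ n) (hf : IsSuperconformal f)
    {j : ℕ} (hj : j ≤ n) (z : ℂ) :
    minkowski (dzIter (n - j) f z) (dzIter (n + j) f z) =
      (-1) ^ j * minkowski (dzIter n f z) (dzIter n f z) := by
  induction j with
  | zero => simp
  | succ j ih =>
    have hs := hf.harmonic.smooth
    have hzero : (fun z => minkowski (dzIter (n - (j + 1)) f z) (dzIter (n + j) f z)) =
        fun _ => 0 := by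
      funext z
      exact hf.minkowski_dzIter_eq_zero hn (by omega) (by omega) z
    have hd := wirtinger_minkowski (contDiff_dzIter hs (n - (j + 1)))
      (contDiff_dzIter hs (n + j)) (-Complex.I) z
    rw [hzero, wirtinger_zero, ← dz_eq_wirtinger, ← dz_eq_wirtinger, ← dzIter_succ, ← dzIter_succ,
      show n - (j + 1) + 1 = n - j by omega, ih (by omega)] at hd
    rw [← add_assoc n j 1, pow_succ]
    linear_combination -hd

end Superconformal

/-! ### Nonvanishing and causal character of the harmonic sequence. -/

section HarmonicSequence

namespace PartialMap

theorem mem_regularSet_of_domain_next_eq_univ {g : PartialMap n} (hdom : g.next.domain = univ)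
    {z : ℂ} (hz : g.toFun z ≠ 0) : z ∈ g.regularSet := by
  have h : z ∈ g.regularSet ∪ g.extensionSet := (eq_univ_iff_forall.1 hdom) z
  exact h.resolve_right fun h => hz h.2.1

theorem next_toFun_of_regularSet_eq_univ {g : PartialMap n} (h : g.regularSet = univ) :
    g.next.toFun = g.gramSchmidt := by
  funext z
  simp [next, h]

theorem contDiff_gramSchmidt_coeff {g : PartialMap n} (hg : ContDiff ℝ ∞ g.toFun)
    (h : ∀ z, hermSq (g.toFun z) ≠ 0) :
    ContDiff ℝ ∞ (fun z => minkowski (dz g.toFun z) (star (g.toFun z)) / hermSq (g.toFun z)) := by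
  have hstar : ContDiff ℝ ∞ (fun z => star (g.toFun z)) := by
    rw [contDiff_pi] at hg ⊢
    exact fun i => Complex.conjCLE.contDiff.comp (hg i)
  simp only [div_eq_mul_inv]
  exact (contDiff_minkowski (contDiff_dz hg) hstar).mul ((contDiff_minkowski hg hstar).inv h)

end PartialMap

variable {f : ℂ → Fin (2 * n + 1) → ℝ}

theorem star_complexify (z : ℂ) : star (complexify f z) = complexify f z := by
  funext i
  simp [complexify]

/-- The correction term vanishes because `⟨∂_z f, f⟩ = 0`. Thus the expansions of all `f_j` start at
order 1; a term of order 0 would spoil their isotropy, as `⟨f, f⟩ = 1`. -/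
theorem IsSuperconformal.harmonicSequence_one (hn : 1 ≤ n) (hf : IsSuperconformal f) :
    (harmonicSequence f 1).toFun = dzIter 1 f := by
  have hreg : (harmonicSequence f 0).regularSet = univ := by
    refine eq_univ_of_forall fun z => ⟨univ_mem, ?_⟩
    change hermSq (complexify f z) ≠ 0
    rw [hermSq, star_complexify, hf.harmonic.minkowski_complexify]
    exact one_ne_zero
  rw [harmonicSequence, PartialMap.next_toFun_of_regularSet_eq_univ hreg]
  funext z
  have h : minkowski (dz (complexify f) z) (complexify f z) = 0 :=
    hf.minkowski_dzIter_eq_zero hn (a := 1) (b := 0) (by omega) (by omega) z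
  change dz (complexify f) z - (minkowski (dz (complexify f) z) (star (complexify f z)) /
    hermSq (complexify f z)) • complexify f z = dz (complexify f) z
  rw [star_complexify, h, zero_div, zero_smul, sub_zero]

/-- Pairing with `∂_z^{2n-j} f` kills the lower terms and leaves `±c ≠ 0`, so `f_j` has no zeros,
and the next element can be defined only where `‖f_j‖² ≠ 0`. -/
theorem IsSuperconformal.mem_regularSet_of_eq_add (hn : 1 ≤ n) (hf : IsSuperconformal f)
    (hper : IsDoublyPeriodic f) {j : ℕ} (hj : 1 ≤ j) (hjn : j ≤ n)
    (hdom : (harmonicSequence f (j + 1)).domain = univ) {e : ℂ → Fin (2 * n + 1) → ℂ}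
    (he : IsDerivComb f 1 j e)
    (heq : (harmonicSequence f j).toFun = fun z => dzIter j f z + e z) (z : ℂ) :
    z ∈ (harmonicSequence f j).regularSet := by
  obtain ⟨c, hc, hconst⟩ := hf.minkowski_dzIter_const hn hper
  refine PartialMap.mem_regularSet_of_domain_next_eq_univ hdom fun h0 => ?_
  have hlow : minkowski (e z) (dzIter (2 * n - j) f z) = 0 :=
    he.minkowski_eq_zero fun k hk hkj =>
      hf.minkowski_dzIter_eq_zero hn (by omega) (by omega) z
  have htop := hf.minkowski_dzIter_add_sub hn (Nat.sub_le n j) z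
  rw [Nat.sub_sub_self hjn, show n + (n - j) = 2 * n - j by omega, hconst] at htop
  have h0' : dzIter j f z + e z = 0 := (congrFun heq z).symm.trans h0
  have h := minkowski_add_left (dzIter j f z) (e z) (dzIter (2 * n - j) f z)
  rw [h0', minkowski_zero_left, hlow, htop, add_zero] at h
  exact mul_ne_zero (pow_ne_zero _ (by norm_num)) hc h.symm

/-- `f_j` is `∂_z^j f` up to a combination of lower derivatives of positive order. -/
theorem IsSuperconformal.exists_harmonicSequence_eq_add (hn : 1 ≤ n) (hf : IsSuperconformal f)
    (hper : IsDoublyPeriodic f)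
    (hdef : ∀ j : ℕ, 1 ≤ j → j ≤ n → (harmonicSequence f j).domain = univ) {j : ℕ} (hj : 1 ≤ j)
    (hjn : j ≤ n) : ∃ e, IsDerivComb f 1 j e ∧
      (harmonicSequence f j).toFun = fun z => dzIter j f z + e z := by
  have hs := hf.harmonic.smooth
  induction j, hj using Nat.le_induction with
  | base => exact ⟨_, .zero, by simp [hf.harmonicSequence_one hn]⟩
  | succ j hj ih =>
    obtain ⟨e, he, heq⟩ := ih (by omega)
    -- Since `f_j` is regular everywhere, the Gram–Schmidt formula holds globally with a smooth
    -- coefficient, and no extension by continuity intervenes.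
    have hreg := hf.mem_regularSet_of_eq_add hn hper hj (by omega)
      (hdef (j + 1) (by omega) hjn) he heq
    have hsj : ContDiff ℝ ∞ (harmonicSequence f j).toFun := by
      rw [heq]
      exact (contDiff_dzIter hs j).add (he.contDiff hs)
    have ha := PartialMap.contDiff_gramSchmidt_coeff hsj fun z => (hreg z).2
    refine ⟨_, ((he.dz hs).add ((he.mono (Nat.le_succ j)).smul ha.neg)).add_smul ha.neg hj
      (Nat.lt_succ_self j), ?_⟩
    rw [harmonicSequence, PartialMap.next_toFun_of_regularSet_eq_univ (eq_univ_of_forall hreg)]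
    funext z
    have hdz : dz (harmonicSequence f j).toFun z = dzIter (j + 1) f z + dz e z := by
      rw [heq, dz_eq_wirtinger, wirtinger_add (contDiff_dzIter hs j) (he.contDiff hs),
        dzIter_succ, dz_eq_wirtinger, dz_eq_wirtinger]
    have hz : (harmonicSequence f j).toFun z = dzIter j f z + e z := congrFun heq z
    rw [PartialMap.gramSchmidt]
    generalize minkowski (dz (harmonicSequence f j).toFun z)
      (star ((harmonicSequence f j).toFun z)) / hermSq ((harmonicSequence f j).toFun z) = a
    rw [hdz, hz]
    module

theorem IsSuperconformal.isSpacelike_harmonicSequence (hn : 1 ≤ n) (hf : IsSuperconformal f)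
    (hper : IsDoublyPeriodic f)
    (hdef : ∀ j : ℕ, 1 ≤ j → j ≤ n → (harmonicSequence f j).domain = univ) {j : ℕ} (hj : 1 ≤ j)
    (hjn : j < n) (z : ℂ) : IsSpacelike ((harmonicSequence f j).toFun z) := by
  obtain ⟨e, he, heq⟩ := hf.exists_harmonicSequence_eq_add hn hper hdef hj hjn.le
  have hne := (hf.mem_regularSet_of_eq_add hn hper hj hjn.le
    (hdef (j + 1) (by omega) hjn) he heq z).2
  -- All orders are between 1 and `j < n`, so every product has total order at most `2n - 2`.
  have hcross {k : ℕ} (hk : 1 ≤ k) (hkj : k ≤ j) : minkowski (e z) (dzIter k f z) = 0 :=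
    he.minkowski_eq_zero fun i _ _ => hf.minkowski_dzIter_eq_zero hn (by omega) (by omega) z
  have hee : minkowski (e z) (e z) = 0 := he.minkowski_eq_zero fun k hk hkj => by
    rw [minkowski_comm]
    exact hcross hk hkj.le
  have hiso : minkowski ((harmonicSequence f j).toFun z) ((harmonicSequence f j).toFun z) = 0 := by
    rw [heq, minkowski_add_left, minkowski_add_right, minkowski_add_right,
      minkowski_comm (dzIter j f z) (e z), hcross hj le_rfl, hee,
      hf.minkowski_dzIter_eq_zero hn (by omega) (by omega)]
    simp
  refine (hermSq_re_nonneg_of_isotropic hiso).lt_of_ne fun h => hne ?_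
  exact Complex.ext h.symm (hermSq_im _)

end HarmonicSequence

end DeSitter

theorem mainTheorem5 (n : ℕ) (hn : 1 ≤ n) (f : ℂ → Fin (2 * n + 1) → ℝ)
    (hper : DeSitter.IsDoublyPeriodic f) (hsc : DeSitter.IsSuperconformal f)
    (hdef : ∀ j : ℕ, 1 ≤ j → j ≤ n → (DeSitter.harmonicSequence f j).domain = Set.univ) :
    (∃ c : ℂ, c ≠ 0 ∧
      ∀ z : ℂ, DeSitter.minkowski (DeSitter.dzIter n f z) (DeSitter.dzIter n f z) = c) ∧
    (∀ j : ℕ, 1 ≤ j → j ≤ n - 1 →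
      ∀ z : ℂ, DeSitter.IsSpacelike ((DeSitter.harmonicSequence f j).toFun z)) :=
  ⟨hsc.minkowski_dzIter_const hn hper, fun _ hj hjn z =>
    hsc.isSpacelike_harmonicSequence hn hper hdef hj (by omega) z⟩
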